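/- Let $N\ge 1$ be an integer, $m,\eta,P,N_0,d_1,d_2>0$, $\alpha\in\mathbb R$ and $0<\tau<1$ real numbers. Let $\mathbf h=(h_1,\dots,h_N)$ be a random vector in $\mathbb C^N$ with independent entries, whose magnitudes $|h_i|$ all have the Nakagami-$m$ density with unit spread, $$p(x)=\frac{2m^m}{\Gamma(m)}\,x^{2m-1}e^{-mx^2},\qquad x\ge 0,$$ and let $g$ be a circularly symmetric complex Gaussian random variable with mean zero and unit variance, independent of $\mathbf h$. Let $$\gamma_N=\frac{\tau\,\eta\,\|\mathbf h\|^2|g|^2P}{(1-\tau)\,d_1^{\alpha}d_2^{\alpha}N_0},\qquad c_1=\frac{d_1^{\alpha}d_2^{\alpha}N_0}{\eta P}$$ ($\gamma_N$ is the end-to-end signal-to-noise ratio of the noise-limited wireless powered link). Then $\log_2(1+\gamma_N)$ is integrable, and the average throughput in delay-tolerant transmission, $R_{\mathsf{DT}}(\tau)=(1-\tau)\,\mathsf E[\log_2(1+\gamma_N)]$, is $$R_{\mathsf{DT}}(\tau)=\frac{(1-\tau)\log_2 e}{\Gamma(mN)}\;G^{1,4}_{4,2}\!\left(\frac{\tau}{(1-\tau)c_1m}\,\middle|\,{1-mN,\,0,\,1,\,1\atop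 1,\,0}\right).$$ Here $G^{k,l}_{p,q}$ is the Meijer G-function, $$G^{k,l}_{p,q}\!\left(z\,\middle|\,{a_1,\dots,a_p\atop b_1,\dots,b_q}\right)=\frac1{2\pi i}\int_L\frac{\prod_{j=1}^{k}\Gamma(b_j-s)\prod_{j=1}^{l}\Gamma(1-a_j+s)}{\prod_{j=k+1}^{q}\Gamma(1-b_j+s)\prod_{j=l+1}^{p}\Gamma(a_j-s)}\,z^s\,ds,$$ where $L$ is a vertical line, directed upwards, with all poles of the factors $\Gamma(b_j-s)$, $j\le k$, to its right and all poles of the factors $\Gamma(1-a_j+s)$, $j\le l$, to its left; for the parameters above such lines exist, the integral along each of them converges absolutely, and its value does not depend on the choice of the line. -/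

import Mathlib

open MeasureTheory ProbabilityTheory
open scoped ENNReal NNReal

noncomputable section

/-! ### The channel laws -/

/-- The Nakagami density with fading parameter `m` and spread `Ω₀` (the mean of the square). -/
def nakagamiPDFReal (m Ω₀ x : ℝ) : ℝ :=
  if 0 ≤ x then
    2 / Real.Gamma m * (m / Ω₀) ^ m * x ^ (2 * m - 1) * Real.exp (-(m / Ω₀) * x ^ 2)
  else 0

/-- The Nakagami distribution on the real line. -/
def nakagamiMeasure (m Ω₀ : ℝ) : Measure ℝ :=
  volume.withDensity (fun x => ENNReal.ofReal (nakagamiPDFReal m Ω₀ x))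

/-- The (circularly symmetric) complex Gaussian distribution with mean zero and unit variance:
real and imaginary part are independent real Gaussians with mean `0` and variance `1/2`. -/
def stdComplexGaussian : Measure ℂ :=
  ((gaussianReal 0 (1 / 2)).prod (gaussianReal 0 (1 / 2))).map
    (fun p : ℝ × ℝ => (⟨p.1, p.2⟩ : ℂ))

/-! ### Signal to noise ratio and throughput -/

/-- The end-to-end signal to noise ratio for the energy-transfer channel vector `h` and the
information channel coefficient `g`: here `τ` is the fraction of the block used for harvesting,
`η` the energy conversion efficiency, `P` the transmit power of the beacon, `N₀` the noise power,
`d₁`, `d₂` the two distances and `α` the path loss exponent. -/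
def snr {N : ℕ} (τ η P N₀ d₁ d₂ α : ℝ) (h : EuclideanSpace ℂ (Fin N)) (g : ℂ) : ℝ :=
  τ * η * ‖h‖ ^ 2 * ‖g‖ ^ 2 * P / ((1 - τ) * d₁ ^ α * d₂ ^ α * N₀)

/-- The ergodic capacity `E[log₂ (1 + γ)]` for a random signal to noise ratio `γ`. -/
def ergodicCapacity {Ω : Type*} [MeasurableSpace Ω] (μ : Measure Ω) (γ : Ω → ℝ) : ℝ :=
  ∫ ω, Real.logb 2 (1 + γ ω) ∂μ

/-- The average throughput in delay tolerant transmission: the fraction `1 - τ` of the block is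
used for information transmission, at the ergodic capacity. -/
def delayTolerantThroughput {Ω : Type*} [MeasurableSpace Ω] (μ : Measure Ω) (τ : ℝ)
    (γ : Ω → ℝ) : ℝ :=
  (1 - τ) * ergodicCapacity μ γ

/-! ### The Meijer G-function -/

/-- The Mellin-Barnes integrand of the Meijer function `G^{m,n}_{p,q}(z | a ; b)`. The upper
parameters `a` and the lower parameters `b` are indexed from `0`, so that the first `m` of the
lower and the first `n` of the upper ones give the Gamma factors of the numerator. -/
def meijerGIntegrand (m n : ℕ) {p q : ℕ} (a : Fin p → ℂ) (b : Fin q → ℂ) (z s : ℂ) : ℂ :=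
  ((∏ j : Fin q with j.val < m, Complex.Gamma (b j - s)) *
      ∏ j : Fin p with j.val < n, Complex.Gamma (1 - a j + s)) /
    ((∏ j : Fin q with m ≤ j.val, Complex.Gamma (1 - b j + s)) *
      ∏ j : Fin p with n ≤ j.val, Complex.Gamma (a j - s)) * z ^ s

/-- The line `Re s = c` separates the poles of the numerator: all poles `b j + k` of the factors
`Γ(b j - s)` lie strictly to its right and all poles `a j - 1 - k` of the factors `Γ(1 - a j + s)`
strictly to its left. -/
def IsMeijerLine (m n : ℕ) {p q : ℕ} (a : Fin p → ℂ) (b : Fin q → ℂ) (c : ℝ) : Prop :=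
  (∀ j : Fin q, j.val < m → ∀ k : ℕ, c < (b j + k).re) ∧
    ∀ j : Fin p, j.val < n → ∀ k : ℕ, (a j - 1 - k).re < c

/-- `w` is the value `G^{m,n}_{p,q}(z | a ; b)` of the Meijer G-function, as the Mellin-Barnes
integral `(2πi)⁻¹ ∫ … ds` upwards along a vertical line that separates the two families of poles:
such lines exist, and along each of them the integral converges absolutely and equals `w`. -/
def HasMeijerG (m n : ℕ) {p q : ℕ} (a : Fin p → ℂ) (b : Fin q → ℂ) (z w : ℂ) : Prop :=
  (∃ c : ℝ, IsMeijerLine m n a b c) ∧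
    ∀ c : ℝ, IsMeijerLine m n a b c →
      Integrable (fun y : ℝ => meijerGIntegrand m n a b z (c + y * Complex.I)) ∧
      (2 * Real.pi * Complex.I)⁻¹ *
        ∫ y : ℝ, meijerGIntegrand m n a b z (c + y * Complex.I) * Complex.I = w

end

/-!
Up to the constant `κ = τ / ((1 - τ) c₁)`, the signal to noise ratio is the product of the
independent variables `X = ‖h‖ ^ 2` and `Y = ‖g‖ ^ 2`. The square of a Nakagami variable is Gamma
distributed with shape and rate `m`, so `X` is Gamma distributed with shape `m N` and rate `m`
(`hasLaw_norm_sq_nakagami`), and `Y` is exponentially distributed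
(`hasLaw_norm_sq_stdComplexGaussian`); both are read off from moment generating functions
(`HasLaw.gammaMeasure_of_mgf`). Hence the complex moments of `κ X Y` are
`Γ(m N + s) Γ(1 + s) (κ / m) ^ s / Γ(m N)` (`integral_cpow_gammaMeasure`).

For `0 < c < 1`, the logarithm is a superposition of powers along the line `Re s = c`,
`2 π i * log (1 + x) = ∫ Γ(s) Γ(1 - s) / s * x ^ s ds`
(`integral_logMellin_mul_cpow`). This is Mellin inversion, applied to the Mellin transform of
`log (1 + x)`, which two Mellin convolutions provide (`hasMellin_log_one_add`); the reflection
formula gives its decay along the line (`integrable_logMellin`). Taking expectations under the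
integral sign (`expectation_log_one_add`) turns `x ^ s` into the moments above, and
`Γ(s) Γ(1 - s) / s * Γ(1 + s) Γ(m N + s) * z ^ s` is exactly the Mellin-Barnes integrand of the Meijer
function (`meijerGIntegrand_eq`). The separating lines are those with `0 < c < 1`
(`isMeijerLine_iff`), so every one of them gives the same value.
-/

open Set Filter Topology

/-! ### Mellin convolution and the Mellin transform of the logarithm -/

/-- The Fubini condition behind the Mellin convolution formula: absolute convergence of the Mellin
transforms of `φ` at `s` and of `w` at `1 - s` is all that is needed. -/
theorem integrable_mellin_convolution_kernel {φ w : ℝ → ℂ} {s : ℂ} (hφ : Measurable φ)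
    (hw : Measurable w) (hφs : MellinConvergent φ s) (hws : MellinConvergent w (1 - s)) :
    Integrable (fun p : ℝ × ℝ => (p.2 : ℂ) ^ (s - 1) * (w p.1 * φ (p.1 * p.2)))
      ((volume.restrict (Ioi 0)).prod (volume.restrict (Ioi 0))) := by
  rw [integrable_prod_iff (by fun_prop)]
  constructor
  · filter_upwards [ae_restrict_mem measurableSet_Ioi] with t ht
    have := ((MellinConvergent.comp_mul_left ht).mpr hφs).const_smul (w t)
    simpa [MellinConvergent, IntegrableOn] using this
  · -- Substituting `x ↦ x / t` makes the inner integral of the norm `t ^ (-s.re) * ‖w t‖` times a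
    -- constant; the first factor is the norm of the Mellin integrand of `w` at `1 - s`.
    have key : ∀ t ∈ Ioi (0 : ℝ),
        ∫ x in Ioi (0 : ℝ), ‖(x : ℂ) ^ (s - 1) * (w t * φ (t * x))‖ =
          ‖(t : ℂ) ^ (1 - s - 1) • w t‖ * ∫ x in Ioi (0 : ℝ), ‖(x : ℂ) ^ (s - 1) • φ x‖ := by
      intro t ht
      have h1 := mellin_comp_mul_left (fun x => ((‖φ x‖ : ℝ) : ℂ)) (s.re : ℂ) ht
      have h2 : ∀ ψ : ℝ → ℂ, mellin (fun x => ((‖ψ x‖ : ℝ) : ℂ)) (s.re : ℂ) =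
          ((∫ x in Ioi (0 : ℝ), ‖(x : ℂ) ^ (s - 1) • ψ x‖ : ℝ) : ℂ) := by
        intro ψ
        rw [mellin, ← integral_complex_ofReal]
        refine setIntegral_congr_fun measurableSet_Ioi fun x hx => ?_
        rw [norm_smul, Complex.norm_cpow_eq_rpow_re_of_pos hx, Complex.ofReal_mul,
          Complex.ofReal_cpow (le_of_lt hx)]
        simp
      rw [h2 (fun x => φ (t * x)), h2 φ] at h1
      have h3 : ‖(t : ℂ) ^ (1 - s - 1) • w t‖ = t ^ (-s.re) * ‖w t‖ := by
        rw [norm_smul, Complex.norm_cpow_eq_rpow_re_of_pos ht]; simp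
      have h4 : ∫ x in Ioi (0 : ℝ), ‖(x : ℂ) ^ (s - 1) • φ (t * x)‖ =
          t ^ (-s.re) * ∫ x in Ioi (0 : ℝ), ‖(x : ℂ) ^ (s - 1) • φ x‖ := by
        apply Complex.ofReal_injective
        rw [h1, Complex.ofReal_mul, Complex.ofReal_cpow (le_of_lt ht)]
        simp
      rw [h3, mul_right_comm, ← h4, mul_comm, ← integral_const_mul]
      congr 1 with x
      simp only [norm_mul, smul_eq_mul]
      ring
    refine Integrable.congr (f := fun t : ℝ => ‖(t : ℂ) ^ (1 - s - 1) • w t‖ *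
      ∫ x in Ioi (0 : ℝ), ‖(x : ℂ) ^ (s - 1) • φ x‖) (hws.norm.mul_const _) ?_
    filter_upwards [ae_restrict_mem measurableSet_Ioi] with t ht
    exact (key t ht).symm

/-- The Mellin transform of the multiplicative convolution `x ↦ ∫ t > 0, w t * φ (t * x)` at `s`
is the product of the transforms of `φ` at `s` and of `w` at `1 - s`. -/
theorem HasMellin.convolution {φ w : ℝ → ℂ} {s A B : ℂ} (hφ : Measurable φ)
    (hw : Measurable w) (hφs : HasMellin φ s A) (hws : HasMellin w (1 - s) B) :
    HasMellin (fun x => ∫ t in Ioi (0 : ℝ), w t * φ (t * x)) s (A * B) := by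
  have hK := integrable_mellin_convolution_kernel hφ hw hφs.1 hws.1
  constructor
  · have := hK.integral_prod_right
    simp only [integral_const_mul] at this
    exact this
  · have := integral_integral_swap
      (f := fun t x : ℝ => (x : ℂ) ^ (s - 1) * (w t * φ (t * x))) hK
    simp only [integral_const_mul] at this
    simp only [mellin, smul_eq_mul]
    rw [← this, ← hws.2, mellin, ← integral_const_mul]
    refine setIntegral_congr_fun measurableSet_Ioi fun t ht => ?_
    have h1 := mellin_comp_mul_left φ s ht
    rw [hφs.2, mellin] at h1
    simp only [smul_eq_mul] at h1 ⊢
    calc _ = ∫ x in Ioi (0 : ℝ), w t * ((x : ℂ) ^ (s - 1) * φ (t * x)) := by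
          congr 1 with x; ring
      _ = _ := by rw [integral_const_mul, h1, show 1 - s - 1 = -s by ring]; ring

theorem hasMellin_exp_neg {s : ℂ} (hs : 0 < s.re) :
    HasMellin (fun x : ℝ => ((Real.exp (-x) : ℝ) : ℂ)) s (Complex.Gamma s) := by
  constructor
  · have := Complex.GammaIntegral_convergent hs
    simpa [MellinConvergent, mul_comm] using this
  · rw [Complex.Gamma_eq_integral hs, Complex.GammaIntegral_eq_mellin]

/-- Mellin convolution of `exp (-x)` with itself, since `1 / (1 + x) = ∫ t > 0, exp (-t) exp (-t x)`. -/
theorem hasMellin_one_div_one_add {s : ℂ} (hs₀ : 0 < s.re) (hs₁ : s.re < 1) :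
    HasMellin (fun x : ℝ => ((1 / (1 + x) : ℝ) : ℂ)) s
      (Complex.Gamma s * Complex.Gamma (1 - s)) := by
  have h := HasMellin.convolution (by fun_prop) (by fun_prop) (hasMellin_exp_neg hs₀)
    (hasMellin_exp_neg (s := 1 - s) (by simpa using hs₁))
  have key : ∀ x ∈ Ioi (0 : ℝ), ∫ t in Ioi (0 : ℝ),
      ((Real.exp (-t) : ℝ) : ℂ) * ((Real.exp (-(t * x)) : ℝ) : ℂ) =
        ((1 / (1 + x) : ℝ) : ℂ) := by
    intro x hx
    simp_rw [← Complex.ofReal_mul, ← Real.exp_add, integral_complex_ofReal]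
    congr 1
    have hx' : -(1 + x) < 0 := by have : 0 < x := hx; linarith
    have := integral_exp_mul_Ioi hx' 0
    simp only [mul_zero, Real.exp_zero] at this
    rw [show 1 / (1 + x) = -1 / -(1 + x) by rw [neg_div_neg_eq], ← this]
    congr 1 with t; congr 1; ring
  constructor
  · refine IntegrableOn.congr_fun h.1 (fun x hx => ?_) measurableSet_Ioi
    simp only [key x hx]
  · rw [← h.2]
    refine setIntegral_congr_fun measurableSet_Ioi fun x hx => ?_
    simp only [key x hx]

/-- Mellin convolution of `x / (1 + x)` with `t⁻¹` on `(0, 1]`, since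
`log (1 + x) = ∫ t in 0..1, x / (1 + t x)`. The transform converges at `-s` for `0 < Re s < 1`: the
logarithm is of order `x` at `0` and grows more slowly than every power at infinity. -/
theorem hasMellin_log_one_add {s : ℂ} (hs₀ : 0 < s.re) (hs₁ : s.re < 1) :
    HasMellin (fun x : ℝ => ((Real.log (1 + x) : ℝ) : ℂ)) (-s)
      (Complex.Gamma s * Complex.Gamma (1 - s) / s) := by
  have hφ : HasMellin (fun x : ℝ => (x : ℂ) ^ (1 : ℂ) • ((1 / (1 + x) : ℝ) : ℂ)) (-s)
      (Complex.Gamma s * Complex.Gamma (1 - s)) := by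
    have h := hasMellin_one_div_one_add (s := 1 - s) (by simpa using hs₁) (by simpa using hs₀)
    rw [sub_sub_cancel, mul_comm] at h
    rw [HasMellin, MellinConvergent.cpow_smul, mellin_cpow_smul, neg_add_eq_sub]
    exact h
  have hw := hasMellin_cpow_Ioc (-1) (s := 1 - -s) (by simpa using hs₀)
  rw [show 1 - -s + -1 = s by ring] at hw
  have h := HasMellin.convolution (by fun_prop)
    (Measurable.indicator (by fun_prop) measurableSet_Ioc) hφ hw
  rw [mul_one_div] at h
  have key : ∀ x ∈ Ioi (0 : ℝ), ∫ t in Ioi (0 : ℝ),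
      (Ioc (0 : ℝ) 1).indicator (fun t : ℝ => (t : ℂ) ^ (-1 : ℂ)) t *
        (((t * x : ℝ) : ℂ) ^ (1 : ℂ) • ((1 / (1 + t * x) : ℝ) : ℂ)) =
        ((Real.log (1 + x) : ℝ) : ℂ) := by
    intro x hx
    have hx : 0 < x := hx
    have e : ∀ t : ℝ, (Ioc (0 : ℝ) 1).indicator (fun t : ℝ => (t : ℂ) ^ (-1 : ℂ)) t *
        (((t * x : ℝ) : ℂ) ^ (1 : ℂ) • ((1 / (1 + t * x) : ℝ) : ℂ)) =
        (Ioc (0 : ℝ) 1).indicator (fun t : ℝ => ((x / (1 + t * x) : ℝ) : ℂ)) t := by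
      intro t
      by_cases ht : t ∈ Ioc (0 : ℝ) 1
      · have ht0 : (t : ℂ) ≠ 0 := by exact_mod_cast ht.1.ne'
        simp only [indicator_of_mem ht, Complex.cpow_one, Complex.cpow_neg_one, smul_eq_mul]
        push_cast
        field_simp
      · simp [indicator_of_notMem ht]
    simp_rw [e]
    rw [setIntegral_indicator measurableSet_Ioc, inter_eq_right.mpr Ioc_subset_Ioi_self,
      integral_complex_ofReal, ← intervalIntegral.integral_of_le zero_le_one]
    congr 1
    have hd : ∀ t ∈ uIcc (0 : ℝ) 1,
        HasDerivAt (fun t => Real.log (1 + t * x)) (x / (1 + t * x)) t := by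
      intro t ht
      rw [uIcc_of_le zero_le_one] at ht
      have : 0 < 1 + t * x := by have := mul_nonneg ht.1 hx.le; linarith
      have h1 : HasDerivAt (fun t => 1 + t * x) x t := by
        simpa using ((hasDerivAt_id t).mul_const x).const_add 1
      exact h1.log this.ne'
    rw [intervalIntegral.integral_eq_sub_of_hasDerivAt hd]
    · simp
    · refine ContinuousOn.intervalIntegrable fun t ht => ContinuousAt.continuousWithinAt ?_
      rw [uIcc_of_le zero_le_one] at ht
      have : 0 < 1 + t * x := by have := mul_nonneg ht.1 hx.le; linarith
      exact ContinuousAt.div (by fun_prop) (by fun_prop) this.ne'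
  constructor
  · refine IntegrableOn.congr_fun h.1 (fun x hx => ?_) measurableSet_Ioi
    simp only [key x hx]
  · rw [← h.2]
    refine setIntegral_congr_fun measurableSet_Ioi fun x hx => ?_
    simp only [key x hx]

/-! ### Mellin inversion for the logarithm -/

theorem one_add_sq_le_four_mul_cosh (y : ℝ) : 1 + y ^ 2 ≤ 4 * Real.cosh y := by
  have h := Real.quadratic_le_exp_of_nonneg (abs_nonneg y)
  rw [sq_abs] at h
  have h2 : Real.exp |y| ≤ 2 * Real.cosh y := by
    rw [← Real.cosh_abs, Real.cosh_eq]
    have := Real.exp_pos (-|y|)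
    linarith
  have := abs_nonneg y
  linarith

/-- On the line `Re s = c` the real part of `sin (π s)` is `sin (π c) cosh (π y)`, so that
`1 / sin (π s)` decays at least like `y⁻²`. -/
theorem norm_sin_pi_mul_ge {c : ℝ} (hc₀ : 0 < c) (hc₁ : c < 1) (y : ℝ) :
    Real.sin (Real.pi * c) * (1 + (Real.pi * y) ^ 2) ≤
      4 * ‖Complex.sin (Real.pi * (c + y * Complex.I))‖ := by
  have hs : 0 ≤ Real.sin (Real.pi * c) :=
    Real.sin_nonneg_of_nonneg_of_le_pi (by positivity) (by nlinarith [Real.pi_pos])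
  have hre : (Complex.sin (Real.pi * (c + y * Complex.I))).re =
      Real.sin (Real.pi * c) * Real.cosh (Real.pi * y) := by
    rw [show (Real.pi : ℂ) * (c + y * Complex.I) =
      ((Real.pi * c : ℝ) : ℂ) + ((Real.pi * y : ℝ) : ℂ) * Complex.I by push_cast; ring,
      Complex.sin_add_mul_I, ← Complex.ofReal_sin, ← Complex.ofReal_cosh, ← Complex.ofReal_cos,
      ← Complex.ofReal_sinh]
    simp [-Complex.ofReal_sin, -Complex.ofReal_cosh, -Complex.ofReal_cos, -Complex.ofReal_sinh]
  calc _ ≤ Real.sin (Real.pi * c) * (4 * Real.cosh (Real.pi * y)) := by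
        gcongr; exact one_add_sq_le_four_mul_cosh _
    _ = 4 * (Complex.sin (Real.pi * (c + y * Complex.I))).re := by rw [hre]; ring
    _ ≤ _ := by gcongr; exact Complex.re_le_norm _

/-- The Mellin transform of `log (1 + x)` is integrable along vertical lines: by the reflection
formula it is `π / (s sin (π s))`. -/
theorem integrable_logMellin {c : ℝ} (hc₀ : 0 < c) (hc₁ : c < 1) :
    Integrable fun y : ℝ => Complex.Gamma (c + y * Complex.I) *
      Complex.Gamma (1 - (c + y * Complex.I)) / (c + y * Complex.I) := by
  have hs : 0 < Real.sin (Real.pi * c) :=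
    Real.sin_pos_of_pos_of_lt_pi (by positivity) (by nlinarith [Real.pi_pos])
  simp_rw [Complex.Gamma_mul_Gamma_one_sub]
  have hI : Integrable fun y : ℝ =>
      4 * Real.pi / (Real.sin (Real.pi * c) * c) * (1 + (Real.pi * y) ^ 2)⁻¹ :=
    (integrable_inv_one_add_sq.comp_mul_left' Real.pi_ne_zero).const_mul _
  refine hI.mono' (Measurable.aestronglyMeasurable (by fun_prop)) (Eventually.of_forall fun y => ?_)
  have h1 := norm_sin_pi_mul_ge hc₀ hc₁ y
  have h2 : c ≤ ‖(c + y * Complex.I : ℂ)‖ := by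
    simpa using Complex.re_le_norm (c + y * Complex.I : ℂ)
  have h3 : 0 < 1 + (Real.pi * y) ^ 2 := by positivity
  have h4 : 0 < ‖Complex.sin (Real.pi * (c + y * Complex.I))‖ := by
    have : 0 < Real.sin (Real.pi * c) * (1 + (Real.pi * y) ^ 2) := by positivity
    linarith
  rw [norm_div, norm_div, Complex.norm_real, Real.norm_of_nonneg Real.pi_pos.le, div_div,
    ← div_eq_mul_inv, div_div, div_le_div_iff₀ (mul_pos h4 (hc₀.trans_le h2)) (by positivity)]
  calc Real.pi * (Real.sin (Real.pi * c) * c * (1 + (Real.pi * y) ^ 2))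
      = Real.pi * ((Real.sin (Real.pi * c) * (1 + (Real.pi * y) ^ 2)) * c) := by ring
    _ ≤ Real.pi * ((4 * ‖Complex.sin (Real.pi * (c + y * Complex.I))‖) *
          ‖(c + y * Complex.I : ℂ)‖) := by gcongr
    _ = _ := by ring

/-- Mellin inversion for `log (1 + x)`. It holds at `x = 0` as well, where both sides vanish. -/
theorem integral_logMellin_mul_cpow {c : ℝ} (hc₀ : 0 < c) (hc₁ : c < 1) {x : ℝ} (hx : 0 ≤ x) :
    ∫ y : ℝ, Complex.Gamma (c + y * Complex.I) *
      Complex.Gamma (1 - (c + y * Complex.I)) / (c + y * Complex.I) *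
        (x : ℂ) ^ (c + y * Complex.I) = 2 * Real.pi * (Real.log (1 + x) : ℝ) := by
  rcases hx.eq_or_lt with rfl | hx
  · have : ∀ y : ℝ, ((0 : ℝ) : ℂ) ^ (c + y * Complex.I) = 0 := by
      intro y
      rw [Complex.ofReal_zero, Complex.zero_cpow]
      intro h
      have := congrArg Complex.re h
      simp at this
      linarith
    simp only [this]
    simp
  have hm : ∀ y : ℝ, mellin (fun x : ℝ => ((Real.log (1 + x) : ℝ) : ℂ))
      (((-c : ℝ) : ℂ) + ((-y : ℝ) : ℂ) * Complex.I) = Complex.Gamma (c + y * Complex.I) *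
      Complex.Gamma (1 - (c + y * Complex.I)) / (c + y * Complex.I) := by
    intro y
    rw [← (hasMellin_log_one_add (s := c + y * Complex.I) (by simpa) (by simpa)).2]
    congr 1
    push_cast
    ring
  have hv : Integrable fun y : ℝ => mellin (fun x : ℝ => ((Real.log (1 + x) : ℝ) : ℂ))
      (((-c : ℝ) : ℂ) + (y : ℂ) * Complex.I) := by
    have := (integrable_logMellin hc₀ hc₁).comp_neg
    refine this.congr (Eventually.of_forall fun y => ?_)
    beta_reduce
    rw [← hm, neg_neg]
  have h := mellinInv_mellin_eq (-c) (fun x : ℝ => ((Real.log (1 + x) : ℝ) : ℂ)) hx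
    (by simpa using (hasMellin_log_one_add (s := c) (by simpa) (by simpa)).1) hv (by
      refine Complex.continuous_ofReal.continuousAt.comp (ContinuousAt.log (by fun_prop) ?_)
      positivity)
  -- The inversion formula runs along `Re s = -c`; reflecting `y` gives powers of `x` with exponent
  -- `c + y I`.
  rw [mellinInv, ← integral_neg_eq_self] at h
  simp only [smul_eq_mul, hm] at h
  rw [← h]
  have hpi : (Real.pi : ℂ) ≠ 0 := by exact_mod_cast Real.pi_ne_zero
  push_cast
  rw [Complex.real_smul]
  push_cast
  rw [← mul_assoc, mul_one_div_cancel (mul_ne_zero two_ne_zero hpi), one_mul]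
  congr 1 with y
  rw [show -(-(c : ℂ) + -y * Complex.I) = c + y * Complex.I by ring]
  ring

/-- The expectation of `log (1 + W)` is a Mellin-Barnes integral of the complex moments of `W`: take
expectations in the Mellin inversion of `log (1 + x)`. As `|W ^ s| = W ^ c` on the line `Re s = c`,
the moment of order `c` justifies the exchange, which also yields both integrability claims. -/
theorem expectation_log_one_add {Ω : Type*} [MeasurableSpace Ω] {μ : Measure Ω} [SFinite μ]
    {W : Ω → ℝ} (hW : AEMeasurable W μ) (hW₀ : ∀ ω, 0 ≤ W ω) {c : ℝ} (hc₀ : 0 < c) (hc₁ : c < 1)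
    (hWc : Integrable (fun ω => W ω ^ c) μ) :
    Integrable (fun ω => Real.log (1 + W ω)) μ ∧
    Integrable (fun y : ℝ => Complex.Gamma (c + y * Complex.I) *
      Complex.Gamma (1 - (c + y * Complex.I)) / (c + y * Complex.I) *
        ∫ ω, (W ω : ℂ) ^ (c + y * Complex.I) ∂μ) ∧
    ∫ y : ℝ, Complex.Gamma (c + y * Complex.I) *
      Complex.Gamma (1 - (c + y * Complex.I)) / (c + y * Complex.I) *
        ∫ ω, (W ω : ℂ) ^ (c + y * Complex.I) ∂μ =
      2 * Real.pi * ((∫ ω, Real.log (1 + W ω) ∂μ : ℝ) : ℂ) := by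
  have hM := integrable_logMellin hc₀ hc₁
  have hK : Integrable (fun p : Ω × ℝ => Complex.Gamma (c + p.2 * Complex.I) *
      Complex.Gamma (1 - (c + p.2 * Complex.I)) / (c + p.2 * Complex.I) *
        (W p.1 : ℂ) ^ (c + p.2 * Complex.I)) (μ.prod volume) := by
    refine (hWc.mul_prod hM.norm).mono (hM.1.comp_snd.mul ?_) (Eventually.of_forall fun p => ?_)
    · have := hW.comp_fst (ν := (volume : Measure ℝ))
      exact AEMeasurable.aestronglyMeasurable (by fun_prop)
    · have : ‖(W p.1 : ℂ) ^ (c + p.2 * Complex.I)‖ = W p.1 ^ c := by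
        rw [Complex.norm_cpow_eq_rpow_re_of_nonneg (hW₀ _)] <;> simp [hc₀.ne']
      rw [norm_mul, norm_mul, this, Real.norm_of_nonneg (Real.rpow_nonneg (hW₀ _) _), norm_norm, mul_comm]
  refine ⟨?_, ?_, ?_⟩
  · have h1 := hK.integral_prod_left
    simp only [integral_logMellin_mul_cpow hc₀ hc₁ (hW₀ _)] at h1
    have h2 := (h1.const_mul (2 * Real.pi : ℂ)⁻¹).re
    refine h2.congr (Eventually.of_forall fun ω => ?_)
    have hpi : (2 * Real.pi : ℂ) ≠ 0 := by
      simp [Real.pi_ne_zero]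
    simp only [inv_mul_cancel_left₀ hpi]
    simp
  · simpa only [integral_const_mul] using hK.integral_prod_right
  · have := integral_integral_swap (f := fun (ω : Ω) (y : ℝ) => Complex.Gamma (c + y * Complex.I) *
      Complex.Gamma (1 - (c + y * Complex.I)) / (c + y * Complex.I) *
        (W ω : ℂ) ^ (c + y * Complex.I)) hK
    simp only [integral_logMellin_mul_cpow hc₀ hc₁ (hW₀ _)] at this
    rw [integral_const_mul, integral_complex_ofReal] at this
    simp only [integral_const_mul] at this
    exact this.symm

/-! ### Integrals and complex moments of the Gamma distribution -/

theorem integral_gammaMeasure {E : Type*} [NormedAddCommGroup E] [NormedSpace ℝ E]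
    {a r : ℝ} (ha : 0 < a) (hr : 0 < r) (f : ℝ → E) :
    ∫ x, f x ∂gammaMeasure a r = ∫ x in Ioi (0 : ℝ),
      (r ^ a / Real.Gamma a * x ^ (a - 1) * Real.exp (-(r * x))) • f x := by
  have hm : Measurable (gammaPDF a r) := (measurable_gammaPDFReal a r).ennreal_ofReal
  rw [gammaMeasure, integral_withDensity_eq_integral_toReal_smul hm (by simp [gammaPDF]),
    ← integral_Ici_eq_integral_Ioi, ← integral_indicator measurableSet_Ici]
  congr 1 with x
  rw [gammaPDF, ENNReal.toReal_ofReal (gammaPDFReal_nonneg ha hr x)]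
  by_cases hx : 0 ≤ x <;> simp [gammaPDFReal, indicator, hx]

theorem integrable_gammaMeasure_iff {E : Type*} [NormedAddCommGroup E] [NormedSpace ℝ E]
    {a r : ℝ} (ha : 0 < a) (hr : 0 < r) (f : ℝ → E) :
    Integrable f (gammaMeasure a r) ↔ IntegrableOn (fun x =>
      (r ^ a / Real.Gamma a * x ^ (a - 1) * Real.exp (-(r * x))) • f x) (Ioi 0) := by
  have hm : Measurable (gammaPDF a r) := (measurable_gammaPDFReal a r).ennreal_ofReal
  rw [gammaMeasure, integrable_withDensity_iff_integrable_smul' hm (by simp [gammaPDF]),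
    ← integrableOn_Ici_iff_integrableOn_Ioi, ← integrable_indicator_iff measurableSet_Ici]
  refine integrable_congr (Eventually.of_forall fun x => ?_)
  beta_reduce
  rw [gammaPDF, ENNReal.toReal_ofReal (gammaPDFReal_nonneg ha hr x)]
  by_cases hx : 0 ≤ x <;> simp [gammaPDFReal, indicator, hx]

theorem integral_cpow_gammaMeasure {a r : ℝ} (ha : 0 < a) (hr : 0 < r) {s : ℂ} (hs : 0 < s.re) :
    ∫ x : ℝ, (x : ℂ) ^ s ∂gammaMeasure a r =
      (r : ℂ) ^ (-s) * Complex.Gamma (a + s) / Real.Gamma a := by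
  have hr' : (r : ℂ) ≠ 0 := by exact_mod_cast hr.ne'
  rw [integral_gammaMeasure ha hr]
  have h1 := Complex.integral_cpow_mul_exp_neg_mul_Ioi (a := a + s) (by simp; linarith) hr
  calc _ = ∫ x in Ioi (0 : ℝ), ((r ^ a / Real.Gamma a : ℝ) : ℂ) *
        ((x : ℂ) ^ (a + s - 1) * Complex.exp (-(r * x))) := by
        refine setIntegral_congr_fun measurableSet_Ioi fun x hx => ?_
        have hx' : (x : ℂ) ≠ 0 := by exact_mod_cast (ne_of_gt hx)
        rw [show (a : ℂ) + s - 1 = ((a - 1 : ℝ) : ℂ) + s by push_cast; ring, Complex.cpow_add _ _ hx',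
          ← Complex.ofReal_cpow (le_of_lt hx), Complex.real_smul]
        push_cast
        ring
    _ = _ := by
      rw [integral_const_mul, h1, one_div, ← Complex.ofReal_inv, Complex.ofReal_inv,
        Complex.inv_cpow _ _ (by rw [Complex.arg_ofReal_of_nonneg hr.le]; exact Real.pi_pos.ne),
        ← Complex.cpow_neg, neg_add, Complex.cpow_add _ _ hr', Complex.ofReal_div,
        Complex.ofReal_cpow hr.le]
      rw [Complex.cpow_neg _ (a : ℂ)]
      have : (r : ℂ) ^ (a : ℂ) ≠ 0 := by simp [Complex.cpow_eq_zero_iff, hr']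
      field_simp

theorem integrable_rpow_gammaMeasure {a r : ℝ} (ha : 0 < a) (hr : 0 < r) {c : ℝ} (hc : 0 < c) :
    Integrable (fun x : ℝ => x ^ c) (gammaMeasure a r) := by
  rw [integrable_gammaMeasure_iff ha hr]
  have h := integrableOn_rpow_mul_exp_neg_mul_rpow (p := 1) (s := a + c - 1) (b := r)
    (by linarith) one_pos hr
  refine IntegrableOn.congr_fun (h.const_mul (r ^ a / Real.Gamma a)) (fun x hx => ?_)
    measurableSet_Ioi
  simp only [Real.rpow_one, smul_eq_mul]
  rw [show a + c - 1 = (a - 1) + c by ring, Real.rpow_add hx, neg_mul]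
  ring

/-! ### Moment generating functions -/

/-- The moment generating function of the Gamma distribution with shape `a` and rate `r`. It takes
the value `0` for `r ≤ t`, where `exp (t x)` is not integrable, in agreement with `mgf`. -/
noncomputable def gammaMGF (a r t : ℝ) : ℝ := if t < r then (r / (r - t)) ^ a else 0

theorem not_integrableOn_rpow_mul_exp_neg_mul {a b p : ℝ} (hb : b ≤ 0) :
    ¬ IntegrableOn (fun x : ℝ => x ^ a * Real.exp (-b * x ^ p)) (Ioi 0) := by
  intro h
  refine not_integrableOn_Ioi_rpow a (h.mono' ?_ ?_)
  · exact Measurable.aestronglyMeasurable (by fun_prop)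
  · filter_upwards [ae_restrict_mem measurableSet_Ioi] with x hx
    have hx : 0 < x := hx
    rw [Real.norm_of_nonneg (by positivity)]
    refine le_mul_of_one_le_right (by positivity) (Real.one_le_exp ?_)
    have := Real.rpow_nonneg hx.le p
    nlinarith

/-- For `b ≤ 0` the integral diverges, and the Bochner integral is `0` by convention. -/
theorem integral_rpow_mul_exp_eq {a b p : ℝ} (ha : 0 < a) (hp : 0 < p) :
    ∫ x in Ioi (0 : ℝ), x ^ (p * a - 1) * Real.exp (-b * x ^ p) =
      if 0 < b then b ^ (-a) * (1 / p) * Real.Gamma a else 0 := by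
  split_ifs with hb
  · rw [integral_rpow_mul_exp_neg_mul_rpow hp (by nlinarith [mul_pos hp ha]) hb]
    congr 3 <;> field_simp <;> ring_nf
  · exact integral_undef (not_integrableOn_rpow_mul_exp_neg_mul (not_lt.mp hb))

theorem mgf_gammaMeasure {a r : ℝ} (ha : 0 < a) (hr : 0 < r) :
    mgf id (gammaMeasure a r) = gammaMGF a r := by
  ext t
  have h := integral_rpow_mul_exp_eq (b := r - t) ha one_pos
  have hG := (Real.Gamma_pos_of_pos ha).ne'
  rw [mgf, integral_gammaMeasure ha hr]
  calc _ = ∫ x in Ioi (0 : ℝ), r ^ a / Real.Gamma a *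
        (x ^ (1 * a - 1) * Real.exp (-(r - t) * x ^ (1 : ℝ))) := by
        congr 1 with x
        rw [id, smul_eq_mul, mul_assoc, mul_assoc, ← Real.exp_add, Real.rpow_one, one_mul]
        ring_nf
    _ = _ := by
      rw [integral_const_mul, h, gammaMGF]
      simp only [sub_pos]
      split_ifs with ht
      · rw [Real.div_rpow hr.le (by linarith), Real.rpow_neg (by linarith)]
        field_simp
      · simp

theorem mgf_sq_nakagamiMeasure {m : ℝ} (hm : 0 < m) :
    mgf (fun x => x ^ 2) (nakagamiMeasure m 1) = gammaMGF m m := by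
  ext t
  have h := integral_rpow_mul_exp_eq (b := m - t) hm two_pos
  have hG := Real.Gamma_pos_of_pos hm
  have hmeas : Measurable (nakagamiPDFReal m 1) := by
    unfold nakagamiPDFReal
    exact Measurable.ite measurableSet_Ici (by fun_prop) measurable_const
  have hnn : ∀ x, 0 ≤ nakagamiPDFReal m 1 x := by
    intro x; unfold nakagamiPDFReal; split_ifs <;> positivity
  rw [mgf, nakagamiMeasure, integral_withDensity_eq_integral_toReal_smul hmeas.ennreal_ofReal
    (by simp)]
  simp_rw [ENNReal.toReal_ofReal (hnn _)]
  calc _ = ∫ x in Ioi (0 : ℝ), 2 / Real.Gamma m * m ^ m *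
        (x ^ (2 * m - 1) * Real.exp (-(m - t) * x ^ (2 : ℝ))) := by
        rw [← integral_Ici_eq_integral_Ioi, ← integral_indicator measurableSet_Ici]
        congr 1 with x
        by_cases hx : 0 ≤ x
        · simp only [nakagamiPDFReal, indicator, hx, mem_Ici, if_true, div_one, smul_eq_mul,
            Real.rpow_two]
          rw [mul_assoc, mul_assoc, ← Real.exp_add]
          ring_nf
        · simp [nakagamiPDFReal, indicator, hx]
    _ = _ := by
      rw [integral_const_mul, h, gammaMGF]
      simp only [sub_pos]
      split_ifs with ht
      · rw [Real.div_rpow hm.le (by linarith), Real.rpow_neg (by linarith)]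
        field_simp
      · simp

theorem mgf_sq_gaussianReal :
    mgf (fun x => x ^ 2) (gaussianReal 0 (1 / 2)) = gammaMGF (1 / 2) 1 := by
  ext t
  rw [mgf, integral_gaussianReal_eq_integral_smul (by norm_num)]
  calc _ = ∫ x : ℝ, (√Real.pi)⁻¹ * Real.exp (-(1 - t) * x ^ 2) := by
        congr 1 with x
        rw [gaussianPDFReal, smul_eq_mul, mul_assoc, ← Real.exp_add]
        have h2 : √(2 * Real.pi * ((1 / 2 : ℝ≥0) : ℝ)) = √Real.pi := by congr 1; push_cast; ring
        rw [h2]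
        push_cast
        ring_nf
    _ = _ := by
      rw [integral_const_mul, integral_gaussian, gammaMGF]
      have hpi := Real.sqrt_ne_zero'.mpr Real.pi_pos
      split_ifs with ht
      · rw [← Real.sqrt_eq_rpow, Real.sqrt_div Real.pi_pos.le, Real.sqrt_div zero_le_one]
        field_simp
        simp
      · rw [Real.sqrt_eq_zero_of_nonpos
          (div_nonpos_of_nonneg_of_nonpos Real.pi_pos.le (by linarith)), mul_zero]

/-- The index set has to be nonempty: at `r ≤ t` the empty product is `1` and not `0`. -/
theorem prod_gammaMGF {ι : Type*} (s : Finset ι) (hs : s.Nonempty) {a r : ℝ} (hr : 0 < r) (t : ℝ) :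
    ∏ _i ∈ s, gammaMGF a r t = gammaMGF (a * s.card) r t := by
  rw [Finset.prod_const, gammaMGF, gammaMGF]
  split_ifs with ht
  · rw [Real.rpow_mul_natCast (div_nonneg hr.le (by linarith))]
  · exact zero_pow (by simpa using hs.ne_empty)

/-- A Gamma law is determined by its moment generating function: the latter is finite near `0`, so
it extends analytically to a strip around the imaginary axis, where it is the characteristic
function. -/
theorem HasLaw.gammaMeasure_of_mgf {Ω : Type*} [MeasurableSpace Ω] {μ : Measure Ω}
    [IsProbabilityMeasure μ] {X : Ω → ℝ} (hX : AEMeasurable X μ) {a r : ℝ} (ha : 0 < a)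
    (hr : 0 < r) (h : mgf X μ = gammaMGF a r) : HasLaw X (gammaMeasure a r) μ := by
  have := isProbabilityMeasure_gammaMeasure ha hr
  have := Measure.isProbabilityMeasure_map hX
  refine ⟨hX, Measure.ext_of_charFun ?_⟩
  have hmgf : mgf X μ = mgf id (gammaMeasure a r) := by rw [h, mgf_gammaMeasure ha hr]
  have h0 : (0 : ℝ) ∈ interior (integrableExpSet X μ) := by
    rw [mem_interior_iff_mem_nhds]
    filter_upwards [Iio_mem_nhds hr] with t ht
    rw [integrableExpSet, mem_ofPred_eq, ← mgf_pos_iff, h, gammaMGF, if_pos (mem_Iio.mp ht)]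
    exact Real.rpow_pos_of_pos (div_pos hr (sub_pos.mpr ht)) _
  ext t
  rw [← complexMGF_mul_I hX, ← complexMGF_id_mul_I]
  exact eqOn_complexMGF_of_mgf hmgf (by simpa using h0)

/-! ### The laws of the channel gains -/

/-- A sum of independent Gamma variables with common shape and rate is Gamma distributed, the shapes
adding up. -/
theorem hasLaw_sum_gammaMeasure {Ω ι : Type*} [MeasurableSpace Ω] {μ : Measure Ω}
    [IsProbabilityMeasure μ] [Fintype ι] [Nonempty ι] {X : ι → Ω → ℝ}
    (hX : ∀ i, AEMeasurable (X i) μ) (hindep : iIndepFun X μ) {a r : ℝ} (ha : 0 < a) (hr : 0 < r)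
    (h : ∀ i, mgf (X i) μ = gammaMGF a r) :
    HasLaw (∑ i, X i) (gammaMeasure (a * Fintype.card ι) r) μ := by
  have hcard : (0 : ℝ) < Fintype.card ι := by exact_mod_cast Fintype.card_pos
  refine HasLaw.gammaMeasure_of_mgf (Finset.aemeasurable_sum _ fun i _ => hX i)
    (mul_pos ha hcard) hr ?_
  ext t
  rw [hindep.mgf_sum₀ hX]
  simp_rw [h]
  rw [prod_gammaMGF _ Finset.univ_nonempty hr, Finset.card_univ]

theorem hasLaw_norm_sq_nakagami {Ω : Type*} [MeasurableSpace Ω] {μ : Measure Ω}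
    [IsProbabilityMeasure μ] {N : ℕ} (hN : 1 ≤ N) {m : ℝ} (hm : 0 < m)
    {h : Ω → EuclideanSpace ℂ (Fin N)}
    (hindep : iIndepFun (fun (i : Fin N) (ω : Ω) => h ω i) μ)
    (hlaw : ∀ i : Fin N, HasLaw (fun ω => ‖h ω i‖) (nakagamiMeasure m 1) μ) :
    HasLaw (fun ω => ‖h ω‖ ^ 2) (gammaMeasure (m * N) m) μ := by
  have : Nonempty (Fin N) := ⟨⟨0, hN⟩⟩
  have hsum := hasLaw_sum_gammaMeasure (X := fun (i : Fin N) ω => ‖h ω i‖ ^ 2)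
    (fun i => (hlaw i).aemeasurable.pow_const 2)
    (hindep.comp (fun _ z => ‖z‖ ^ 2) fun _ => by fun_prop) hm hm fun i => by
      rw [← mgf_sq_nakagamiMeasure hm]
      ext t
      exact (hlaw i).integral_comp (f := fun x => Real.exp (t * x ^ 2))
        (Measurable.aestronglyMeasurable (by fun_prop))
  rw [Fintype.card_fin] at hsum
  convert! hsum using 1
  ext ω
  rw [EuclideanSpace.norm_sq_eq, Finset.sum_apply]

/-- The squares of the real and the imaginary part are independent Gamma variables with shape `1 / 2`
and rate `1`, so that the squared modulus is exponentially distributed. -/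
theorem hasLaw_norm_sq_stdComplexGaussian :
    HasLaw (fun z : ℂ => ‖z‖ ^ 2) (gammaMeasure 1 1) stdComplexGaussian := by
  have hmeas : Measurable (fun p : ℝ × ℝ => (⟨p.1, p.2⟩ : ℂ)) :=
    Complex.measurableEquivRealProd.symm.measurable
  have : IsProbabilityMeasure stdComplexGaussian :=
    Measure.isProbabilityMeasure_map hmeas.aemeasurable
  refine HasLaw.gammaMeasure_of_mgf (by fun_prop) one_pos one_pos ?_
  ext t
  have hg := mgf_sq_gaussianReal
  have ht : gammaMGF (1 / 2) 1 t * gammaMGF (1 / 2) 1 t = gammaMGF 1 1 t := by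
    have := prod_gammaMGF (Finset.univ : Finset (Fin 2)) Finset.univ_nonempty one_pos t (a := 1 / 2)
    simpa [sq] using this
  rw [← ht, ← hg, mgf, stdComplexGaussian, integral_map hmeas.aemeasurable
    (Measurable.aestronglyMeasurable (by fun_prop)), mgf, ← integral_prod_mul]
  congr 1 with p
  rw [← Real.exp_add, Complex.sq_norm, Complex.normSq_mk]
  ring_nf

/-! ### The Mellin-Barnes integral as an expectation -/

/-- The lower parameter `0` cancels one Gamma factor `Γ(1 + s)`; the two factors `Γ(s)` are rewritten
as `Γ(s) Γ(1 + s) / s`, to show the Mellin transform of the logarithm and two Gamma moments. -/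
theorem meijerGIntegrand_eq {K z c y : ℝ} (hc₀ : 0 < c) :
    meijerGIntegrand 1 4 ![1 - (K : ℂ), 0, 1, 1] ![1, 0] z (c + y * Complex.I) =
      Complex.Gamma (c + y * Complex.I) *
        Complex.Gamma (1 - (c + y * Complex.I)) / (c + y * Complex.I) *
        (Complex.Gamma (K + (c + y * Complex.I)) * Complex.Gamma (1 + (c + y * Complex.I)) *
          (z : ℂ) ^ (c + y * Complex.I)) := by
  set s : ℂ := c + y * Complex.I with hs
  have hre : 0 < s.re := by simpa [hs] using hc₀
  have hs0 : s ≠ 0 := fun h => by simp [h] at hre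
  have h1 : Complex.Gamma (1 + s) ≠ 0 :=
    Complex.Gamma_ne_zero_of_re_pos (by simp; linarith)
  have h2 : Complex.Gamma (1 + s) = s * Complex.Gamma s := by
    rw [add_comm, Complex.Gamma_add_one _ hs0]
  have hG : Complex.Gamma s ≠ 0 := Complex.Gamma_ne_zero_of_re_pos hre
  simp only [meijerGIntegrand, Finset.prod_filter, Fin.prod_univ_succ, Fin.prod_univ_zero]
  simp
  rw [h2]
  field_simp

/-- The nearest poles are `1` on the right, from the lower parameter `1`, and `0` on the left, from
the two upper parameters equal to `1`. -/
theorem isMeijerLine_iff {K c : ℝ} (hK : 0 < K) :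
    IsMeijerLine 1 4 ![1 - (K : ℂ), 0, 1, 1] ![1, 0] c ↔ 0 < c ∧ c < 1 := by
  constructor
  · rintro ⟨h1, h2⟩
    have h1 := h1 0 (by simp) 0
    have h2 := h2 2 (by simp) 0
    simp at h1 h2
    exact ⟨h2, h1⟩
  · rintro ⟨h1, h2⟩
    constructor
    · intro j hj k
      have hj : j = 0 := by ext; simpa using hj
      have hk : (0 : ℝ) ≤ k := k.cast_nonneg
      subst hj
      simp
      linarith
    · intro j _ k
      have hk : (0 : ℝ) ≤ k := k.cast_nonneg
      fin_cases j <;> simp <;> linarith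

/-- The expectation of `log (1 + κ X Y)` for independent `X`, with a Gamma law, and `Y`, with the
standard exponential law, is a Meijer G-function at `κ / r`, up to the factor `Γ(K)`. -/
theorem hasMeijerG_of_gamma_product {Ω : Type*} [MeasurableSpace Ω] {μ : Measure Ω}
    [IsProbabilityMeasure μ] {X Y : Ω → ℝ} {K r κ : ℝ} (hK : 0 < K) (hr : 0 < r) (hκ : 0 < κ)
    (hX : HasLaw X (gammaMeasure K r) μ) (hY : HasLaw Y (gammaMeasure 1 1) μ)
    (hX₀ : ∀ ω, 0 ≤ X ω) (hY₀ : ∀ ω, 0 ≤ Y ω) (hXY : IndepFun X Y μ) :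
    Integrable (fun ω => Real.log (1 + κ * X ω * Y ω)) μ ∧
      HasMeijerG 1 4 ![1 - (K : ℂ), 0, 1, 1] ![1, 0] ((κ / r : ℝ) : ℂ)
        ((Real.Gamma K * ∫ ω, Real.log (1 + κ * X ω * Y ω) ∂μ : ℝ) : ℂ) := by
  have hW : AEMeasurable (fun ω => κ * X ω * Y ω) μ :=
    (hX.aemeasurable.const_mul κ).mul hY.aemeasurable
  have hW₀ : ∀ ω, 0 ≤ κ * X ω * Y ω := fun ω => mul_nonneg (mul_nonneg hκ.le (hX₀ ω)) (hY₀ ω)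
  have hWc : ∀ c : ℝ, 0 < c → Integrable (fun ω => (κ * X ω * Y ω) ^ c) μ := by
    intro c hc
    have hXc := Integrable.comp_aemeasurable
      (hX.map_eq ▸ integrable_rpow_gammaMeasure hK hr hc) hX.aemeasurable
    have hYc := Integrable.comp_aemeasurable
      (hY.map_eq ▸ integrable_rpow_gammaMeasure one_pos one_pos hc) hY.aemeasurable
    have hi := (hXY.comp (φ := fun x => x ^ c) (ψ := fun x => x ^ c) (by fun_prop)
      (by fun_prop)).integrable_mul hXc hYc
    refine (hi.const_mul (κ ^ c)).congr (Eventually.of_forall fun ω => ?_)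
    simp only [Pi.mul_apply, Function.comp_apply]
    rw [Real.mul_rpow (mul_nonneg hκ.le (hX₀ ω)) (hY₀ ω), Real.mul_rpow hκ.le (hX₀ ω), mul_assoc]
  have hWs : ∀ s : ℂ, 0 < s.re → ∫ ω, ((κ * X ω * Y ω : ℝ) : ℂ) ^ s ∂μ =
      (Complex.Gamma (K + s) * Complex.Gamma (1 + s) * ((κ / r : ℝ) : ℂ) ^ s) / Real.Gamma K := by
    intro s hs
    have hXs := hX.integral_comp (f := fun x : ℝ => (x : ℂ) ^ s)
      (Measurable.aestronglyMeasurable (by fun_prop))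
    have hYs := hY.integral_comp (f := fun x : ℝ => (x : ℂ) ^ s)
      (Measurable.aestronglyMeasurable (by fun_prop))
    rw [integral_cpow_gammaMeasure hK hr hs] at hXs
    rw [integral_cpow_gammaMeasure one_pos one_pos hs] at hYs
    have hi := (hXY.comp (φ := fun x : ℝ => (x : ℂ) ^ s) (ψ := fun x : ℝ => (x : ℂ) ^ s)
      (by fun_prop) (by fun_prop)).integral_mul_eq_mul_integral
      (AEMeasurable.aestronglyMeasurable (by have := hX.aemeasurable; fun_prop))
      (AEMeasurable.aestronglyMeasurable (by have := hY.aemeasurable; fun_prop))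
    rw [hXs, hYs] at hi
    calc _ = ∫ ω, (κ : ℂ) ^ s *
            (((fun x : ℝ => (x : ℂ) ^ s) ∘ X) * ((fun x : ℝ => (x : ℂ) ^ s) ∘ Y)) ω ∂μ := by
          congr 1 with ω
          simp only [Pi.mul_apply, Function.comp_apply]
          rw [Complex.ofReal_mul, Complex.mul_cpow_ofReal_nonneg (mul_nonneg hκ.le (hX₀ ω)) (hY₀ ω),
            Complex.ofReal_mul, Complex.mul_cpow_ofReal_nonneg hκ.le (hX₀ ω), mul_assoc]
      _ = _ := by
          rw [integral_const_mul, hi, div_eq_mul_inv κ r, Complex.ofReal_mul,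
            Complex.mul_cpow_ofReal_nonneg hκ.le (inv_nonneg.mpr hr.le), Complex.ofReal_inv,
            Complex.inv_cpow _ _ (by rw [Complex.arg_ofReal_of_nonneg hr.le]; exact Real.pi_pos.ne),
            ← Complex.cpow_neg]
          simp
          ring
  have hΓ : (Real.Gamma K : ℂ) ≠ 0 := by exact_mod_cast (Real.Gamma_pos_of_pos hK).ne'
  -- Any abscissa in `(0, 1)` would do.
  refine ⟨(expectation_log_one_add hW hW₀ (c := 1 / 2) (by norm_num) (by norm_num)
    (hWc _ (by norm_num))).1, ⟨1 / 2, (isMeijerLine_iff hK).mpr (by norm_num)⟩, fun c hc => ?_⟩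
  obtain ⟨hc₀, hc₁⟩ := (isMeijerLine_iff hK).mp hc
  obtain ⟨-, hint, hval⟩ := expectation_log_one_add hW hW₀ hc₀ hc₁ (hWc c hc₀)
  have hG : ∀ y : ℝ, meijerGIntegrand 1 4 ![1 - (K : ℂ), 0, 1, 1] ![1, 0] ((κ / r : ℝ) : ℂ)
      (c + y * Complex.I) = Real.Gamma K * (Complex.Gamma (c + y * Complex.I) *
        Complex.Gamma (1 - (c + y * Complex.I)) / (c + y * Complex.I) *
        ∫ ω, ((κ * X ω * Y ω : ℝ) : ℂ) ^ (c + y * Complex.I) ∂μ) := by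
    intro y
    rw [meijerGIntegrand_eq hc₀, hWs _ (by simpa using hc₀)]
    field_simp
  simp_rw [hG]
  refine ⟨hint.const_mul _, ?_⟩
  rw [integral_mul_const, integral_const_mul, hval]
  have hpi : (Real.pi : ℂ) ≠ 0 := by exact_mod_cast Real.pi_ne_zero
  push_cast
  field_simp

theorem proposition2 {Ω : Type*} [MeasurableSpace Ω] (μ : Measure Ω) [IsProbabilityMeasure μ]
    (N : ℕ) (hN : 1 ≤ N) (m τ η P N₀ d₁ d₂ α c₁ : ℝ)
    (hm : 0 < m) (hτ₀ : 0 < τ) (hτ₁ : τ < 1) (hη : 0 < η) (hP : 0 < P) (hN₀ : 0 < N₀)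
    (hd₁ : 0 < d₁) (hd₂ : 0 < d₂)
    (hc₁ : c₁ = d₁ ^ α * d₂ ^ α * N₀ / (η * P))
    (h : Ω → EuclideanSpace ℂ (Fin N)) (g : Ω → ℂ)
    (hh_indep : iIndepFun (fun (i : Fin N) (ω : Ω) => h ω i) μ)
    (hh_law : ∀ i : Fin N, HasLaw (fun ω => ‖h ω i‖) (nakagamiMeasure m 1) μ)
    (hg_law : HasLaw g stdComplexGaussian μ)
    (hhg : IndepFun h g μ) :
    Integrable (fun ω => Real.logb 2 (1 + snr τ η P N₀ d₁ d₂ α (h ω) (g ω))) μ ∧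
      ∃ G : ℝ,
        HasMeijerG 1 4 ![1 - (m : ℂ) * (N : ℂ), 0, 1, 1] ![1, 0]
          ((τ / ((1 - τ) * c₁ * m) : ℝ) : ℂ) (G : ℂ) ∧
        delayTolerantThroughput μ τ (fun ω => snr τ η P N₀ d₁ d₂ α (h ω) (g ω)) =
          (1 - τ) * Real.logb 2 (Real.exp 1) / Real.Gamma (m * N) * G := by
  have hτ : 0 < 1 - τ := sub_pos.mpr hτ₁
  have hNpos : (0 : ℝ) < N := by exact_mod_cast hN
  have hK : 0 < m * N := mul_pos hm hNpos
  have hc₁' : 0 < c₁ := by rw [hc₁]; positivity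
  have hsnr : ∀ ω, snr τ η P N₀ d₁ d₂ α (h ω) (g ω) =
      τ / ((1 - τ) * c₁) * ‖h ω‖ ^ 2 * ‖g ω‖ ^ 2 := by
    intro ω
    have := (Real.rpow_pos_of_pos hd₁ α).ne'
    have := (Real.rpow_pos_of_pos hd₂ α).ne'
    rw [snr, hc₁]
    field_simp
  obtain ⟨hint, hG⟩ := hasMeijerG_of_gamma_product hK hm (κ := τ / ((1 - τ) * c₁)) (by positivity)
    (hasLaw_norm_sq_nakagami hN hm hh_indep hh_law)
    (hasLaw_norm_sq_stdComplexGaussian.comp hg_law)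
    (fun ω => by positivity) (fun ω => by simp only [Function.comp_apply]; positivity)
    (hhg.comp (φ := fun v => ‖v‖ ^ 2) (ψ := fun z => ‖z‖ ^ 2) (by fun_prop) (by fun_prop))
  simp only [Function.comp_apply] at hint hG
  simp only [delayTolerantThroughput, ergodicCapacity, hsnr, Real.logb]
  rw [div_div, Complex.ofReal_mul m, Complex.ofReal_natCast] at hG
  refine ⟨hint.div_const _, _, hG, ?_⟩
  rw [integral_div, Real.log_exp]
  have := (Real.Gamma_pos_of_pos hK).ne'
  field_simp
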